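/- For a metric space $(M,d)$ with a distinguished point $0\in M$ let $\mathrm{Lip}_0(M)$ be the Banach space of real-valued Lipschitz functions $f$ on $M$ with $f(0)=0$, normed by the least Lipschitz constant $\|f\|=\sup_{x\ne y}|f(x)-f(y)|/d(x,y)$, and let the Lipschitz-free space be $$\mathcal F(M)=\overline{\mathrm{span}}\{\delta(x) : x\in M\}\subset \mathrm{Lip}_0(M)^*,\qquad \delta(x)(f)=f(x).$$ Up to linear isometry, $\mathcal F(M)$ does not depend on the choice of the distinguished point. For a bounded sequence $(x_n)$ in a real Banach space $X$ put $$\mathrm{ca}(x_n)=\inf_{n\in\mathbb N}\mathrm{diam}\{x_k : k\ge n\},\qquad \delta(x_n)=\sup\{\mathrm{ca}(x^*(x_n)) : x^*\in X^*,\ \|x^*\|\le 1\}.$$ The space $X$ is called $c$-Schur if $\mathrm{ca}(x_n)\le c\,\delta(x_n)$ for every bounded sequence $(x_n)$ in $X$. A metric space $M$ is uniformly discrete if there is $r>0$ with $d(x,y)\ge r$ for all distinct $x,y\in M$. Theorem. For every non-empty uniformly discrete metric space $M$, the space $\mathcal F(M)$ is $3$-Schur. Moreover, the constant $3$ is optimal: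 there is a non-empty uniformly discrete metric space $M$ such that $\mathcal F(M)$ is not $c$-Schur for any real $c<3$. -/

import Mathlib

open scoped NNReal

namespace LipFree

section LipZero

variable {M : Type*} [MetricSpace M]

/-- A metric space is uniformly discrete if the distances of distinct points are bounded
below by a positive constant. -/
def UniformlyDiscrete (M : Type*) [MetricSpace M] : Prop :=
  ∃ r : ℝ, 0 < r ∧ ∀ x y : M, x ≠ y → r ≤ dist x y

/-- The vector space of real-valued Lipschitz functions on `M` that vanish at the
distinguished point `o`. -/
def lipZeroSubmodule (o : M) : Submodule ℝ (M → ℝ) where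
  carrier := {f | (∃ K : ℝ≥0, LipschitzWith K f) ∧ f o = 0}
  add_mem' := by
    rintro f g ⟨⟨K, hf⟩, hf0⟩ ⟨⟨L, hg⟩, hg0⟩
    exact ⟨⟨K + L, hf.add hg⟩, by simp [hf0, hg0]⟩
  zero_mem' := ⟨⟨0, LipschitzWith.const 0⟩, rfl⟩
  smul_mem' := by
    rintro c f ⟨⟨K, hf⟩, hf0⟩
    refine ⟨⟨‖c‖₊ * K, LipschitzWith.of_dist_le_mul fun x y => ?_⟩, by simp [hf0]⟩
    have h := hf.dist_le_mul x y
    simp only [Pi.smul_apply, dist_smul₀, NNReal.coe_mul, coe_nnnorm, mul_assoc]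
    gcongr

/-- The space `Lip₀(M)`. It is a type of its own, so that it carries the topology of the
Lipschitz norm and not that of pointwise convergence. -/
def LipZero (o : M) : Type _ := lipZeroSubmodule o

namespace LipZero

variable {o : M}

instance : AddCommGroup (LipZero o) := inferInstanceAs (AddCommGroup (lipZeroSubmodule o))

instance : Module ℝ (LipZero o) := inferInstanceAs (Module ℝ (lipZeroSubmodule o))

instance : FunLike (LipZero o) M ℝ where
  coe f := f.1
  coe_injective := Subtype.val_injective

@[ext] theorem ext {f g : LipZero o} (h : ∀ x, f x = g x) : f = g := DFunLike.ext f g h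

@[simp] theorem add_apply (f g : LipZero o) (x : M) : (f + g) x = f x + g x := rfl

@[simp] theorem smul_apply (c : ℝ) (f : LipZero o) (x : M) : (c • f) x = c * f x := rfl

@[simp] theorem zero_apply (x : M) : (0 : LipZero o) x = 0 := rfl

@[simp] theorem apply_base (f : LipZero o) : f o = 0 := f.2.2

/-- The norm of `Lip₀(M)`, which is the supremum of the quotients `|f x - f y| / d(x, y)`.
The pairs with `x = y` contribute `0 / 0 = 0`, which does not change the supremum. -/
noncomputable instance : Norm (LipZero o) where
  norm f := ⨆ p : M × M, |f p.1 - f p.2| / dist p.1 p.2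

theorem norm_def (f : LipZero o) : ‖f‖ = ⨆ p : M × M, |f p.1 - f p.2| / dist p.1 p.2 := rfl

theorem bddAbove_quotients (f : LipZero o) :
    BddAbove (Set.range fun p : M × M => |f p.1 - f p.2| / dist p.1 p.2) := by
  obtain ⟨K, hK⟩ := f.2.1
  refine ⟨K, ?_⟩
  rintro _ ⟨p, rfl⟩
  exact div_le_of_le_mul₀ dist_nonneg K.2 (hK.dist_le_mul p.1 p.2)

theorem norm_nonneg' (f : LipZero o) : 0 ≤ ‖f‖ :=
  Real.iSup_nonneg fun _ => div_nonneg (abs_nonneg _) dist_nonneg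

theorem abs_sub_le (f : LipZero o) (x y : M) : |f x - f y| ≤ ‖f‖ * dist x y := by
  rcases eq_or_ne x y with rfl | h
  · simp
  · rw [← div_le_iff₀ (dist_pos.2 h)]
    exact le_ciSup (bddAbove_quotients f) (x, y)

theorem norm_le_of_abs_sub_le (f : LipZero o) {K : ℝ} (hK : 0 ≤ K)
    (h : ∀ x y, |f x - f y| ≤ K * dist x y) : ‖f‖ ≤ K :=
  Real.iSup_le (fun p => div_le_of_le_mul₀ dist_nonneg hK (h p.1 p.2)) hK

theorem abs_apply_le (f : LipZero o) (x : M) : |f x| ≤ ‖f‖ * dist x o := by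
  simpa using abs_sub_le f x o

theorem normCore : NormedSpace.Core ℝ (LipZero o) where
  norm_nonneg := norm_nonneg'
  norm_smul c f := by
    simp only [norm_def, Real.norm_eq_abs, smul_apply, ← mul_sub, abs_mul, mul_div_assoc]
    exact (Real.mul_iSup_of_nonneg (abs_nonneg c) _).symm
  norm_triangle f g := by
    refine norm_le_of_abs_sub_le _ (add_nonneg (norm_nonneg' f) (norm_nonneg' g)) fun x y => ?_
    have h1 := abs_sub_le f x y
    have h2 := abs_sub_le g x y
    have h3 := abs_add_le (f x - f y) (g x - g y)
    rw [add_apply, add_apply, add_sub_add_comm, add_mul]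
    linarith
  norm_eq_zero_iff f := by
    constructor
    · intro h
      ext x
      have := abs_apply_le f x
      rw [h, zero_mul] at this
      exact abs_nonpos_iff.1 this
    · rintro rfl
      simp [norm_def]

noncomputable instance : NormedAddCommGroup (LipZero o) := NormedAddCommGroup.ofCore normCore

noncomputable instance : NormedSpace ℝ (LipZero o) := NormedSpace.ofCore normCore

/-- The evaluation functional `δ(x) : f ↦ f x` on `Lip₀(M)`. -/
noncomputable def eval (o x : M) : StrongDual ℝ (LipZero o) :=
  LinearMap.mkContinuous
    { toFun := fun f => f x
      map_add' := fun f g => add_apply f g x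
      map_smul' := fun c f => smul_apply c f x }
    (dist x o) fun f => by
      simpa [mul_comm] using abs_apply_le f x

@[simp] theorem eval_apply (o x : M) (f : LipZero o) : eval o x f = f x := rfl

end LipZero

/-- The Lipschitz-free space `F(M)` of the metric space `M` with distinguished point `o`: the
closed linear span of the evaluation functionals in the dual of `Lip₀(M)`, with the norm of
that dual. -/
noncomputable def freeSpace (o : M) : Submodule ℝ (StrongDual ℝ (LipZero o)) :=
  (Submodule.span ℝ (Set.range (LipZero.eval o))).topologicalClosure

end LipZero

section Schur

/-- The oscillation `ca(x_n) = inf_n diam {x_k : k ≥ n}` of a (bounded) sequence. -/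
noncomputable def ca {E : Type*} [PseudoMetricSpace E] (x : ℕ → E) : ℝ :=
  ⨅ n : ℕ, Metric.diam (x '' Set.Ici n)

/-- The quantity `δ(x_n)`, which is the supremum of `ca(φ(x_n))` over the functionals `φ` in the
closed unit ball of the dual space. For a bounded sequence the supremum is over a set that is
nonempty and bounded above. -/
noncomputable def weakCa {X : Type*} [NormedAddCommGroup X] [NormedSpace ℝ X] (x : ℕ → X) : ℝ :=
  sSup {t : ℝ | ∃ φ : StrongDual ℝ X, ‖φ‖ ≤ 1 ∧ t = ca fun n => φ (x n)}

/-- A real normed space is `c`-Schur if `ca(x_n) ≤ c δ(x_n)` for all bounded sequences. -/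
def IsSchur (c : ℝ) (X : Type*) [NormedAddCommGroup X] [NormedSpace ℝ X] : Prop :=
  ∀ x : ℕ → X, Bornology.IsBounded (Set.range x) → ca x ≤ c * weakCa x

end Schur

end LipFree

/-! Suppose `ca x` > c > 3 `weakCa x`. Differences of late terms with norm above c are approximated
by finitely supported measures `a k`, nearly normed by 1-Lipschitz functions `f k`; uniform
discreteness bounds the total variations. The heart is `exists_isLip_three`: a single 3-Lipschitz P
nearly norms infinitely many `a k`, and evaluation at P/3 then contradicts the choice of c.

To glue the `f k` into P, let g be their limit along an ultrafilter. Up to a small error, each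
measure lives near the base point or very far from it (`exists_radius_annulus_small`), and far
points are compatible with all earlier data for the constant 3. For near points, x of a later
measure `a n` and z of an earlier one `a i`, `f n x` is within d(x,z) of `f n z`, which is close to
g z; so the constant 3 works unless |f i z - g z| exceeds about 2 d(x,z). The exceptional x form the
set `conflict`. A point lies in boundedly many of these (`card_conflict_le`), so bounded variation
lets a subsequence have little mass on them. McShane extension finishes.

For optimality, the two pair differences of one block of `PairedBlocks` are 6 apart, while by
pigeonhole a functional of norm at most one is eventually at most about 1 in absolute value on pair
differences, hence oscillates by at most 2. -/

namespace LipFree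

open Filter Topology

/-! ### Finitely supported measures and their total variation. -/

section Measures

variable {M : Type*}

/-- The integral of `f` against the finitely supported measure `a`. -/
noncomputable def pair (f : M → ℝ) (a : M →₀ ℝ) : ℝ := ∑ x ∈ a.support, a x * f x

theorem pair_add (f g : M → ℝ) (a : M →₀ ℝ) :
    pair (fun x => f x + g x) a = pair f a + pair g a := by
  simp only [pair, mul_add, Finset.sum_add_distrib]

theorem pair_sub (f g : M → ℝ) (a : M →₀ ℝ) :
    pair (fun x => f x - g x) a = pair f a - pair g a := by
  simp only [pair, mul_sub, Finset.sum_sub_distrib]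

theorem pair_neg (f : M → ℝ) (a : M →₀ ℝ) : pair (fun x => -f x) a = -pair f a := by
  simp only [pair, mul_neg, Finset.sum_neg_distrib]

theorem pair_smul (c : ℝ) (f : M → ℝ) (a : M →₀ ℝ) :
    pair (fun x => c * f x) a = c * pair f a := by
  simp only [pair, Finset.mul_sum]
  exact Finset.sum_congr rfl fun x _ => by ring

/-- The total variation of `a` on `A`. -/
noncomputable def mass (a : M →₀ ℝ) (A : Set M) : ℝ :=
  ∑ x ∈ a.support, A.indicator (fun x => |a x|) x

theorem mass_nonneg (a : M →₀ ℝ) (A : Set M) : 0 ≤ mass a A :=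
  Finset.sum_nonneg fun _ _ => Set.indicator_nonneg (fun _ _ => abs_nonneg _) _

theorem mass_le (a : M →₀ ℝ) (A : Set M) : mass a A ≤ ∑ x ∈ a.support, |a x| :=
  Finset.sum_le_sum fun _ _ => Set.indicator_le_self' (fun _ _ => abs_nonneg _) _

theorem sum_mass_le (a : M →₀ ℝ) (A : ℕ → Set M) {T : ℕ}
    (hT : ∀ x : M, ∀ I : Finset ℕ, (∀ i ∈ I, x ∈ A i) → I.card ≤ T) (I : Finset ℕ) :
    ∑ i ∈ I, mass a (A i) ≤ T * ∑ x ∈ a.support, |a x| := by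
  classical
  unfold mass
  rw [Finset.sum_comm, Finset.mul_sum]
  refine Finset.sum_le_sum fun x _ => ?_
  simp only [Set.indicator_apply]
  rw [← Finset.sum_filter, Finset.sum_const, nsmul_eq_mul]
  refine mul_le_mul_of_nonneg_right ?_ (abs_nonneg _)
  exact_mod_cast hT x _ fun i hi => (Finset.mem_filter.1 hi).2

end Measures

/-! ### Lipschitz functions: extension and cutoff. -/

section Core

variable {M : Type*} [MetricSpace M]

/-- The real function `f` is `K`-Lipschitz. -/
def IsLip (K : ℝ) (f : M → ℝ) : Prop := ∀ x y, |f x - f y| ≤ K * dist x y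

theorem IsLip.neg {K : ℝ} {f : M → ℝ} (hf : IsLip K f) : IsLip K fun x => -f x := by
  intro x y
  have := hf x y
  rwa [neg_sub_neg, abs_sub_comm]

theorem IsLip.const_mul {K : ℝ} {f : M → ℝ} (hf : IsLip K f) {c : ℝ} (hc : 0 ≤ c) :
    IsLip (c * K) fun x => c * f x := by
  intro x y
  rw [← mul_sub, abs_mul, abs_of_nonneg hc, mul_assoc]
  exact mul_le_mul_of_nonneg_left (hf x y) hc

theorem IsLip.abs_le {K : ℝ} {f : M → ℝ} (hf : IsLip K f) {o : M} (h0 : f o = 0) (x : M) :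
    |f x| ≤ K * dist x o := by
  simpa [h0] using hf x o

/-- Almost consistent Lipschitz data are realized, up to the same error, by a Lipschitz function. -/
theorem exists_isLip_of_data {ι : Type*} [Nonempty ι] (p : ι → M) (v : ι → ℝ) {L e : ℝ}
    (hL : 0 ≤ L) (h : ∀ i j, v i ≤ v j + L * dist (p i) (p j) + e) :
    ∃ P : M → ℝ, IsLip L P ∧ ∀ i, v i - e ≤ P (p i) ∧ P (p i) ≤ v i := by
  have hbdd : ∀ x, BddBelow (Set.range fun i => v i + L * dist x (p i)) := by
    intro x
    obtain ⟨i0⟩ := ‹Nonempty ι›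
    refine ⟨v i0 - e - L * dist x (p i0), ?_⟩
    rintro _ ⟨i, rfl⟩
    have h1 := h i0 i
    have h2 : L * dist (p i0) (p i) ≤ L * (dist x (p i0) + dist x (p i)) :=
      mul_le_mul_of_nonneg_left (dist_triangle_left _ _ _) hL
    simp only
    linarith
  have key : ∀ x y, (⨅ i, v i + L * dist x (p i)) ≤ (⨅ i, v i + L * dist y (p i)) + L * dist x y := by
    intro x y
    rw [← sub_le_iff_le_add]
    refine le_ciInf fun i => ?_
    have h1 : (⨅ i, v i + L * dist x (p i)) ≤ v i + L * dist x (p i) := ciInf_le (hbdd x) i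
    have h2 : L * dist x (p i) ≤ L * (dist x y + dist y (p i)) :=
      mul_le_mul_of_nonneg_left (dist_triangle _ _ _) hL
    linarith
  -- McShane's formula. The error `e` enters only the lower bound, since the index `i` itself gives
  -- the upper one.
  refine ⟨fun x => ⨅ i, v i + L * dist x (p i), fun x y => ?_, fun i => ⟨?_, ?_⟩⟩
  · have h1 := key x y
    have h2 := key y x
    rw [dist_comm y x] at h2
    rw [abs_le]
    constructor <;> linarith
  · refine le_ciInf fun j => ?_
    have := h i j
    linarith
  · simpa using ciInf_le (hbdd (p i)) i

/-- The cutoff function that is `1` on the ball of radius `R` and `0` off the ball of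
radius `2R`. -/
noncomputable def cutoff (o : M) (R : ℝ) (x : M) : ℝ := min 1 (max 0 (2 - dist x o / R))

theorem cutoff_nonneg (o : M) (R : ℝ) (x : M) : 0 ≤ cutoff o R x :=
  le_min zero_le_one (le_max_left _ _)

theorem cutoff_le_one (o : M) (R : ℝ) (x : M) : cutoff o R x ≤ 1 := min_le_left _ _

theorem cutoff_eq_one {o : M} {R : ℝ} (hR : 0 < R) {x : M} (h : dist x o ≤ R) :
    cutoff o R x = 1 := by
  have : dist x o / R ≤ 1 := (div_le_one hR).2 h
  exact min_eq_left (le_max_of_le_right (by linarith))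

theorem cutoff_eq_zero {o : M} {R : ℝ} (hR : 0 < R) {x : M} (h : 2 * R ≤ dist x o) :
    cutoff o R x = 0 := by
  have : 2 ≤ dist x o / R := (le_div_iff₀ hR).2 h
  rw [cutoff, max_eq_left (by linarith), min_eq_right zero_le_one]

theorem abs_cutoff_sub_le (o : M) {R : ℝ} (hR : 0 < R) (x y : M) :
    |cutoff o R x - cutoff o R y| ≤ dist x y / R := by
  have h1 : |cutoff o R x - cutoff o R y| ≤ |(2 - dist x o / R) - (2 - dist y o / R)| := by
    refine (abs_min_sub_min_le_max _ _ _ _).trans ?_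
    rw [sub_self, abs_zero, max_eq_right (abs_nonneg _)]
    refine (abs_max_sub_max_le_max _ _ _ _).trans ?_
    rw [sub_self, abs_zero, max_eq_right (abs_nonneg _)]
  refine h1.trans ?_
  rw [show (2 - dist x o / R) - (2 - dist y o / R) = (dist y o - dist x o) / R by ring, abs_div,
    abs_of_pos hR]
  gcongr
  have := abs_dist_sub_le y x o
  rwa [dist_comm y x] at this

/-- Product rule with `f` evaluated at the point z nearer to `o`: either z is beyond 2R and both
products vanish, or |f z| ≤ 2RL, which the slope 1/R of the cutoff turns into 2L. -/
theorem IsLip.mul_cutoff {L : ℝ} (hL : 0 ≤ L) {f : M → ℝ} (hf : IsLip L f) {o : M} (h0 : f o = 0)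
    {R : ℝ} (hR : 0 < R) : IsLip (3 * L) fun x => f x * cutoff o R x := by
  have key : ∀ x z : M, dist z o ≤ dist x o →
      |f x * cutoff o R x - f z * cutoff o R z| ≤ 3 * L * dist x z := by
    intro x z hzx
    have hd : 0 ≤ L * dist x z := mul_nonneg hL dist_nonneg
    rcases le_or_gt (2 * R) (dist z o) with h | h
    · rw [cutoff_eq_zero hR h, cutoff_eq_zero hR (h.trans hzx)]
      simp only [mul_zero, sub_self, abs_zero]
      linarith
    · have e : f x * cutoff o R x - f z * cutoff o R z =
          (f x - f z) * cutoff o R x + f z * (cutoff o R x - cutoff o R z) := by ring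
      have h1 : |(f x - f z) * cutoff o R x| ≤ L * dist x z := by
        rw [abs_mul, abs_of_nonneg (cutoff_nonneg o R x)]
        exact (mul_le_of_le_one_right (abs_nonneg _) (cutoff_le_one o R x)).trans (hf x z)
      have h2 : |f z * (cutoff o R x - cutoff o R z)| ≤ 2 * (L * dist x z) := by
        rw [abs_mul]
        have h3 : |f z| ≤ L * (2 * R) :=
          (hf.abs_le h0 z).trans (mul_le_mul_of_nonneg_left h.le hL)
        refine (mul_le_mul h3 (abs_cutoff_sub_le o hR x z) (abs_nonneg _) (by positivity)).trans ?_
        apply le_of_eq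
        field_simp
      rw [e]
      have := abs_add_le ((f x - f z) * cutoff o R x) (f z * (cutoff o R x - cutoff o R z))
      linarith
  intro x y
  rcases le_total (dist y o) (dist x o) with h | h
  · exact key x y h
  · have := key y x h
    rwa [abs_sub_comm, dist_comm] at this

/-- Cutting a Lipschitz function off to an annulus preserves the Lipschitz property. -/
theorem IsLip.mul_cutoff_sub {L : ℝ} (hL : 0 ≤ L) {f : M → ℝ} (hf : IsLip L f) {o : M}
    (h0 : f o = 0) {R R' : ℝ} (hR : 0 < R) (hR' : 0 < R') :
    IsLip (6 * L) fun x => f x * (cutoff o R' x - cutoff o R x) := by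
  intro x y
  have h1 := hf.mul_cutoff hL h0 hR x y
  have h2 := hf.mul_cutoff hL h0 hR' x y
  rw [_root_.abs_le] at h1 h2 ⊢
  constructor <;> linarith [h1.1, h1.2, h2.1, h2.2]

theorem pair_le_of_isLip {a : M →₀ ℝ} {o : M} {C : ℝ}
    (hC : ∀ f : M → ℝ, IsLip 1 f → f o = 0 → pair f a ≤ C) {K : ℝ} (hK : 0 < K) {f : M → ℝ}
    (hf : IsLip K f) (h0 : f o = 0) : pair f a ≤ K * C := by
  have h1 : IsLip 1 fun x => K⁻¹ * f x := by
    have := hf.const_mul (inv_nonneg.2 hK.le)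
    rwa [inv_mul_cancel₀ hK.ne'] at this
  have h2 := hC _ h1 (by simp [h0])
  rw [pair_smul, inv_mul_le_iff₀ hK] at h2
  exact h2

/-! ### Smallness on annuli. -/

/-- A norm bounded sequence of measures has, in the limit, no mass far from the base point but
near no point at infinity. -/
theorem exists_radius_annulus_small (U : Ultrafilter ℕ) (a : ℕ → M →₀ ℝ) {o : M} {C : ℝ}
    (hC : ∀ k, ∀ f : M → ℝ, IsLip 1 f → f o = 0 → pair f (a k) ≤ C) {ε : ℝ} (hε : 0 < ε) :
    ∃ R : ℝ, 0 < R ∧ ∀ R' : ℝ, ∀ᶠ k in (U : Filter ℕ), ∀ f : M → ℝ, IsLip 1 f →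
      (∀ x, f x ≠ 0 → R ≤ dist x o ∧ dist x o < R') → |pair f (a k)| ≤ ε := by
  by_contra hcon
  push Not at hcon
  -- If every radius fails, functions on successive annuli can be stacked. The bound by `dist x z`
  -- makes `F` vanish beyond `R` and decay towards it, so the constant stays 2 for any number of
  -- layers while the pairing grows without bound.
  have claim : ∀ T : ℕ, ∃ R : ℝ, 0 < R ∧ ∀ᶠ k in (U : Filter ℕ), ∃ F : M → ℝ, IsLip 2 F ∧
      F o = 0 ∧ (∀ x z, R ≤ dist z o → |F x| ≤ dist x z) ∧ T * ε ≤ pair F (a k) := by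
    intro T
    induction T with
    | zero =>
      refine ⟨1, one_pos, Eventually.of_forall fun k => ⟨fun _ => 0, ?_, rfl, ?_, ?_⟩⟩
      · intro x y
        simp
      · intro x z _
        simp
      · simp [pair]
    | succ T ih =>
      obtain ⟨R, hR, hT⟩ := ih
      obtain ⟨R', hR'⟩ := hcon R hR
      refine ⟨max R R', lt_max_of_lt_left hR, ?_⟩
      filter_upwards [hT, hR'] with k hk hk'
      obtain ⟨F, hF, hF0, hFR, hFT⟩ := hk
      obtain ⟨f, hf, hfs, hfε⟩ : ∃ f : M → ℝ, IsLip 1 f ∧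
          (∀ x, f x ≠ 0 → R ≤ dist x o ∧ dist x o < R') ∧ ε < pair f (a k) := by
        obtain ⟨f, hf, hfs, hfε⟩ := hk'
        rcases lt_abs.1 hfε with h | h
        · exact ⟨f, hf, hfs, h⟩
        · exact ⟨fun x => -f x, hf.neg, fun x hx => hfs x (by simpa using hx), by rwa [pair_neg]⟩
      have hf0 : ∀ x, dist x o < R → f x = 0 := fun x hx => by
        by_contra h
        exact absurd (hfs x h).1 (not_le.2 hx)
      have hfR : ∀ x, R' ≤ dist x o → f x = 0 := fun x hx => by
        by_contra h
        exact absurd (hfs x h).2 (not_lt.2 hx)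
      have hF0' : ∀ x, R ≤ dist x o → F x = 0 := fun x hx => by
        have := hFR x x hx
        rw [dist_self] at this
        exact abs_nonpos_iff.1 this
      have mixed : ∀ x z, dist x o < R → R ≤ dist z o → |F x - f z| ≤ 2 * dist x z := by
        intro x z hx hz
        have h1 := hFR x z hz
        have h2 := hf x z
        rw [hf0 x hx, zero_sub, abs_neg] at h2
        have := abs_sub (F x) (f z)
        linarith
      refine ⟨fun x => F x + f x, ?_, ?_, ?_, ?_⟩
      · intro x z
        rcases lt_or_ge (dist x o) R with hx | hx <;> rcases lt_or_ge (dist z o) R with hz | hz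
        · simpa [hf0 x hx, hf0 z hz] using hF x z
        · simpa [hf0 x hx, hF0' z hz] using mixed x z hx hz
        · have := mixed z x hz hx
          rw [dist_comm, abs_sub_comm] at this
          simpa [hf0 z hz, hF0' x hx] using this
        · have h1 := hf x z
          have h2 : (0 : ℝ) ≤ dist x z := dist_nonneg
          simp only [hF0' x hx, hF0' z hz, zero_add]
          linarith
      · simp [hF0, hf0 o (by simpa using hR)]
      · intro x z hz
        rcases lt_or_ge (dist x o) R with hx | hx
        · simpa [hf0 x hx] using hFR x z ((le_max_left _ _).trans hz)
        · have := hf x z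
          rw [hfR z ((le_max_right _ _).trans hz)] at this
          simpa [hF0' x hx] using this
      · rw [pair_add]
        push_cast
        linarith
  obtain ⟨T, hT⟩ := exists_nat_gt (2 * C / ε)
  obtain ⟨R, -, h⟩ := claim T
  obtain ⟨k, F, hF, hF0, -, hFT⟩ := h.exists
  have h1 := pair_le_of_isLip (hC k) two_pos hF hF0
  rw [div_lt_iff₀ hε] at hT
  linarith

theorem exists_tendsto_ultrafilter (U : Ultrafilter ℕ) (u : ℕ → ℝ) {B : ℝ} (h : ∀ k, |u k| ≤ B) :
    ∃ l, Tendsto u U (𝓝 l) := by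
  have hc : IsCompact (Set.Icc (-B) B) := isCompact_Icc
  obtain ⟨l, -, hl⟩ := hc.ultrafilter_le_nhds (U.map u) (by
    rw [le_principal_iff]
    exact Filter.mem_map.2 (Filter.univ_mem' fun k => abs_le.1 (h k)))
  exact ⟨l, hl⟩

theorem abs_sub_lt_of_floor_div_eq {u v η : ℝ} (hη : 0 < η) (h : ⌊u / η⌋ = ⌊v / η⌋) :
    |u - v| < η := by
  have := Int.abs_sub_lt_one_of_floor_eq_floor h
  rwa [← sub_div, abs_div, abs_of_pos hη, div_lt_one hη] at this

/-! ### Conflict sets and gluing along a subsequence. -/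

/-- The points near the support of `a` where a function that is close to `g` near infinity would
conflict with the values of `f` on the support of `a`. -/
def conflict (a : M →₀ ℝ) (f g : M → ℝ) (o : M) (R η : ℝ) : Set M :=
  {x | ∃ z ∈ a.support, dist z o ≤ R ∧ 2 * dist x z + 4 * η ≤ |f z - g z|}

/-- Pigeonhole on the values of `g` and `f i` at the witnesses `z i`, rounded to multiples of η. If
they agree for i < j, then comparing through `f j (z i)`, which is close to `g (z i)`, bounds both
deviations by dist (z i) (z j) + 3η. Adding the two conflict inequalities contradicts the triangle
inequality through `x`. -/
theorem card_conflict_le {a : ℕ → M →₀ ℝ} {f : ℕ → M → ℝ} {g : M → ℝ} {o : M} {R η : ℝ}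
    (hη : 0 < η) (hf : ∀ k, IsLip 1 (f k)) (hf0 : ∀ k, f k o = 0) (hg : IsLip 1 g) (hg0 : g o = 0)
    (hfg : ∀ i j, i < j → ∀ z ∈ (a i).support, |f j z - g z| ≤ η) :
    ∃ T : ℕ, ∀ x : M, ∀ I : Finset ℕ, (∀ i ∈ I, x ∈ conflict (a i) (f i) g o R η) →
      I.card ≤ T := by
  set B : Finset ℤ := Finset.Icc ⌊-R / η⌋ ⌊R / η⌋ with hB
  refine ⟨(B ×ˢ B).card, fun x I hI => ?_⟩
  have : Nonempty M := ⟨x⟩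
  choose! z hzs hzR hz using hI
  have hfloor : ∀ u : ℝ, |u| ≤ R → ⌊u / η⌋ ∈ B := by
    intro u hu
    rw [abs_le] at hu
    rw [hB, Finset.mem_Icc]
    exact ⟨Int.floor_le_floor (by gcongr; exact hu.1), Int.floor_le_floor (by gcongr; exact hu.2)⟩
  have key : ∀ i ∈ I, ∀ j ∈ I, i < j → ⌊g (z i) / η⌋ = ⌊g (z j) / η⌋ →
      ⌊f i (z i) / η⌋ = ⌊f j (z j) / η⌋ → False := by
    intro i hi j hj hij h1 h2
    have h1 := (abs_sub_lt_of_floor_div_eq hη h1).le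
    have h2 := (abs_sub_lt_of_floor_div_eq hη h2).le
    have h3 := hfg i j hij (z i) (hzs i hi)
    have h4 := hf j (z i) (z j)
    have h5 := hz i hi
    have h6 := hz j hj
    have h7 := dist_triangle_left (z i) (z j) x
    have h8 : |f i (z i) - g (z i)| ≤ |f j (z i) - f j (z j)| + 3 * η := by
      have e : f i (z i) - g (z i) = (f i (z i) - f j (z j)) + (-(f j (z i) - f j (z j)))
        + (f j (z i) - g (z i)) := by ring
      have := abs_add_three (f i (z i) - f j (z j)) (-(f j (z i) - f j (z j)))
        (f j (z i) - g (z i))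
      rw [← e, abs_neg] at this
      linarith
    have h9 : |f j (z j) - g (z j)| ≤ |f j (z i) - f j (z j)| + 3 * η := by
      have e : f j (z j) - g (z j) = (g (z i) - g (z j)) + (-(f j (z i) - f j (z j)))
        + (f j (z i) - g (z i)) := by ring
      have := abs_add_three (g (z i) - g (z j)) (-(f j (z i) - f j (z j)))
        (f j (z i) - g (z i))
      rw [← e, abs_neg] at this
      linarith
    linarith
  refine Finset.card_le_card_of_injOn (fun i => (⌊g (z i) / η⌋, ⌊f i (z i) / η⌋)) ?_ ?_
  · intro i hi
    refine Finset.mem_coe.2 (Finset.mem_product.2 ⟨hfloor _ ?_, hfloor _ ?_⟩)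
    · have := hg.abs_le hg0 (z i)
      linarith [hzR i hi]
    · have := (hf i).abs_le (hf0 i) (z i)
      linarith [hzR i hi]
  · intro i hi j hj h
    obtain ⟨h1, h2⟩ := Prod.mk.inj h
    rcases lt_trichotomy i j with hij | hij | hij
    · exact (key i hi j hj hij h1 h2).elim
    · exact hij
    · exact (key j hj i hi hij h1.symm h2.symm).elim

theorem IsLip.of_tendsto {U : Ultrafilter ℕ} {f : ℕ → M → ℝ} {g : M → ℝ} {K : ℝ}
    (hf : ∀ k, IsLip K (f k)) (h : ∀ x, Tendsto (fun k => f k x) U (𝓝 (g x))) : IsLip K g :=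
  fun x y => le_of_tendsto ((h x).sub (h y)).abs (Eventually.of_forall fun k => hf k x y)

/-- A subsequence along which the values of `f i` on the support of `a i` can be glued
together. The numbers `ρ i` are radii beyond which the `i`-th measure is new. -/
theorem exists_subsequence_almost_consistent {a : ℕ → M →₀ ℝ} {o : M} {C C₁ : ℝ}
    (hC : ∀ k, ∀ f : M → ℝ, IsLip 1 f → f o = 0 → pair f (a k) ≤ C)
    (hC₁ : ∀ k, ∑ x ∈ (a k).support, |a k x| ≤ C₁)
    {f : ℕ → M → ℝ} (hf : ∀ k, IsLip 1 (f k)) (hf0 : ∀ k, f k o = 0) {ε : ℝ} (hε : 0 < ε) :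
    ∃ R : ℝ, 0 < R ∧ ∀ η > 0, ∀ ε' > 0, ∃ g : M → ℝ, IsLip 1 g ∧ g o = 0 ∧
      ∃ (s : ℕ → ℕ) (ρ : ℕ → ℝ), StrictMono s ∧ (∀ n, 4 * R ≤ ρ n) ∧
      (∀ n, ∀ h : M → ℝ, IsLip 1 h → (∀ x, h x ≠ 0 → R ≤ dist x o ∧ dist x o < 2 * ρ n) →
        |pair h (a (s n))| ≤ ε) ∧
      (∀ i n, i < n → ∀ z ∈ (a (s i)).support, |f (s n) z - g z| ≤ η ∧ 2 * dist z o ≤ ρ n) ∧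
      ∀ n, ∑ i ∈ Finset.range n,
        mass (a (s n)) (conflict (a (s i)) (f (s i)) g o (2 * R) η) ≤ ε' := by
  classical
  set U : Ultrafilter ℕ := hyperfilter ℕ with hU
  obtain ⟨R, hR, hRs⟩ := exists_radius_annulus_small U a hC hε
  -- `R` is fixed before `ε'` because the later choice of `ε'` is proportional to 1/R.
  refine ⟨R, hR, fun η hη ε' hε' => ?_⟩
  have hlim : ∀ x, ∃ l, Tendsto (fun k => f k x) U (𝓝 l) := fun x =>
    exists_tendsto_ultrafilter U _ fun k => (hf k).abs_le (hf0 k) x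
  choose g hg using hlim
  have hgL : IsLip 1 g := IsLip.of_tendsto hf hg
  have hg0 : g o = 0 := by
    refine tendsto_nhds_unique (hg o) ?_
    simp only [hf0]
    exact tendsto_const_nhds
  refine ⟨g, hgL, hg0, ?_⟩
  set N : ℕ → Set M := fun i => conflict (a i) (f i) g o (2 * R) η with hN
  have hmlim : ∀ i, ∃ l, Tendsto (fun k => mass (a k) (N i)) U (𝓝 l) := fun i =>
    exists_tendsto_ultrafilter U _ (B := C₁) fun k => by
      rw [abs_of_nonneg (mass_nonneg _ _)]
      exact (mass_le _ _).trans (hC₁ k)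
  choose m hm using hmlim
  have hm0 : ∀ i, 0 ≤ m i := fun i =>
    ge_of_tendsto (hm i) (Eventually.of_forall fun k => mass_nonneg _ _)
  -- Indices and radii are chosen together. The slack (1/2)^p over the limit mass is summable.
  obtain ⟨t, htP, htr⟩ := exists_seq_of_forall_finset_exists
    (fun p : ℕ × ℝ => 4 * R ≤ p.2 ∧ ∀ h : M → ℝ, IsLip 1 h →
      (∀ x, h x ≠ 0 → R ≤ dist x o ∧ dist x o < 2 * p.2) → |pair h (a p.1)| ≤ ε)
    (fun p q : ℕ × ℝ => p.1 < q.1 ∧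
      (∀ z ∈ (a p.1).support, |f q.1 z - g z| ≤ η ∧ 2 * dist z o ≤ q.2) ∧
      mass (a q.1) (N p.1) ≤ m p.1 + (1 / 2) ^ p.1) (by
    intro S _
    obtain ⟨ρ, hρ4, hρ⟩ : ∃ ρ : ℝ, 4 * R ≤ ρ ∧
        ∀ p ∈ S, ∀ z ∈ (a p.1).support, 2 * dist z o ≤ ρ := by
      obtain ⟨ρ, hρ⟩ := ((S.biUnion fun p => (a p.1).support).image
        fun z => 2 * dist z o).bddAbove
      refine ⟨max (4 * R) ρ, le_max_left _ _, fun p hp z hz => le_max_of_le_right (hρ ?_)⟩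
      exact Finset.mem_coe.2 (Finset.mem_image_of_mem _ (Finset.mem_biUnion.2 ⟨p, hp, hz⟩))
    have h1 : ∀ᶠ k in (U : Filter ℕ), ∀ p ∈ S, p.1 < k := by
      rw [Filter.eventually_all_finset]
      intro p _
      have : ∀ᶠ k in (cofinite : Filter ℕ), p.1 < k := by
        rw [Nat.cofinite_eq_atTop]
        exact eventually_gt_atTop _
      exact hyperfilter_le_cofinite this
    have h2 : ∀ᶠ k in (U : Filter ℕ), ∀ p ∈ S, ∀ z ∈ (a p.1).support, |f k z - g z| ≤ η := by
      rw [Filter.eventually_all_finset]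
      intro p _
      rw [Filter.eventually_all_finset]
      intro z _
      have := (hg z).eventually (Metric.closedBall_mem_nhds _ hη)
      filter_upwards [this] with k hk
      simpa [Real.dist_eq] using hk
    have h3 : ∀ᶠ k in (U : Filter ℕ), ∀ p ∈ S, mass (a k) (N p.1) ≤ m p.1 + (1 / 2) ^ p.1 := by
      rw [Filter.eventually_all_finset]
      intro p _
      exact (hm p.1).eventually_le_const (lt_add_of_pos_right _ (by positivity))
    obtain ⟨k, hk1, hk2, hk3, hk4⟩ := (h1.and (h2.and (h3.and (hRs (2 * ρ))))).exists
    exact ⟨(k, ρ), ⟨hρ4, hk4⟩, fun p hp =>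
      ⟨hk1 p hp, fun z hz => ⟨hk2 p hp z hz, hρ p hp z hz⟩, hk3 p hp⟩⟩)
  have htmono : StrictMono fun n => (t n).1 := fun i n hin => (htr i n hin).1
  obtain ⟨T, hT⟩ := card_conflict_le (a := fun n => a (t n).1) (f := fun n => f (t n).1)
    (R := 2 * R) hη (fun k => hf _) (fun k => hf0 _) hgL hg0
    (fun i j hij z hz => ((htr i j hij).2.1 z hz).1)
  have hC₁0 : 0 ≤ C₁ := (Finset.sum_nonneg fun _ _ => abs_nonneg _).trans (hC₁ 0)
  -- Bounded overlap makes the limit masses summable; dropping an initial segment of the subsequence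
  -- then pushes the total below `ε'`.
  have hmsum : ∀ I : Finset ℕ, ∑ i ∈ I, m (t i).1 ≤ T * C₁ := by
    intro I
    refine le_of_tendsto (tendsto_finsetSum I fun i _ => hm (t i).1)
      (Eventually.of_forall fun k => ?_)
    exact (sum_mass_le (a k) (fun i => N (t i).1) hT I).trans
      (mul_le_mul_of_nonneg_left (hC₁ k) (Nat.cast_nonneg _))
  have hsum : Summable fun i => m (t i).1 + (1 / 2 : ℝ) ^ (t i).1 := by
    refine (summable_of_sum_le (fun i => hm0 _) hmsum).add ?_
    exact summable_geometric_two.comp_injective htmono.injective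
  obtain ⟨n₀, hn₀⟩ : ∃ n₀, ∀ n, ∑ i ∈ Finset.range n,
      (m (t (n₀ + i)).1 + (1 / 2 : ℝ) ^ (t (n₀ + i)).1) ≤ ε' := by
    have h0 := tendsto_sum_nat_add fun i => m (t i).1 + (1 / 2 : ℝ) ^ (t i).1
    obtain ⟨n₀, hn₀⟩ := (h0.eventually_le_const hε').exists
    refine ⟨n₀, fun n => le_trans ?_ hn₀⟩
    have hs := (summable_nat_add_iff n₀).2 hsum
    simp only [add_comm n₀]
    exact hs.sum_le_tsum _ fun i _ => add_nonneg (hm0 _) (by positivity)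
  refine ⟨fun n => (t (n₀ + n)).1, fun n => (t (n₀ + n)).2, fun i n hin => htmono (by omega),
    fun n => (htP _).1, fun n => (htP _).2, fun i n hin => (htr _ _ (by omega)).2.1,
    fun n => le_trans (Finset.sum_le_sum fun i hi => ?_) (hn₀ n)⟩
  exact (htr (n₀ + i) (n₀ + n) (by have := Finset.mem_range.1 hi; omega)).2.2

/-- Norming functions of a norm bounded sequence of measures, the total variations of which are
bounded as well, can be replaced by a single `3`-Lipschitz function. -/
theorem exists_isLip_three {a : ℕ → M →₀ ℝ} {o : M} {C C₁ : ℝ}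
    (hC : ∀ k, ∀ f : M → ℝ, IsLip 1 f → f o = 0 → pair f (a k) ≤ C)
    (hC₁ : ∀ k, ∑ x ∈ (a k).support, |a k x| ≤ C₁)
    {f : ℕ → M → ℝ} (hf : ∀ k, IsLip 1 (f k)) (hf0 : ∀ k, f k o = 0) {c : ℝ}
    (hc : ∀ k, c ≤ pair (f k) (a k)) {ε : ℝ} (hε : 0 < ε) :
    ∃ P : M → ℝ, IsLip 3 P ∧ P o = 0 ∧ ∀ N, ∃ k ≥ N, c - ε ≤ pair P (a k) := by
  have hC₁0 : 0 ≤ C₁ := (Finset.sum_nonneg fun _ _ => abs_nonneg _).trans (hC₁ 0)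
  obtain ⟨R, hR, H⟩ := exists_subsequence_almost_consistent hC hC₁ hf hf0
    (ε := ε / 72) (by positivity)
  obtain ⟨g, hgL, hg0, s, ρ, hs, hρ, hsmall, hgf, hmass⟩ :=
    H (ε / (15 * (C₁ + 1))) (by positivity) (ε / (24 * R)) (by positivity)
  set η := ε / (15 * (C₁ + 1)) with hη
  have hη0 : 0 < η := by positivity
  set N : ℕ → Set M := fun i => conflict (a (s i)) (f (s i)) g o (2 * R) η with hN
  -- The points where P has to follow `f (s n)`. Nothing is prescribed between 2R and `ρ n`, where
  -- the cutoff weight leaves only a negligible pairing.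
  set D : ℕ → Set M := fun n => {x | x ∈ (a (s n)).support ∧
    (ρ n ≤ dist x o ∨ dist x o ≤ 2 * R ∧ ∀ i < n, x ∉ N i)} with hD
  have hfabs : ∀ n x, |f n x| ≤ dist x o := fun n x => by
    simpa using (hf n).abs_le (hf0 n) x
  have hcons : ∀ i n, i < n → ∀ x ∈ D n, ∀ z ∈ D i,
      |f (s n) x - f (s i) z| ≤ 3 * dist x z + 5 * η := by
    intro i n hin x hx z hz
    have hx1 := hfabs (s n) x
    have hz1 := hfabs (s i) z
    have habs := abs_sub (f (s n) x) (f (s i) z)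
    obtain ⟨hgz, hzρ⟩ := hgf i n hin z hz.1
    have ht1 := dist_triangle x z o
    have ht2 := dist_triangle_left z o x
    rcases hx.2 with hxρ | ⟨hxR, hxN⟩
    -- Here dist x o ≥ 2 dist z o, so dist z o ≤ dist x z and dist x o + dist z o ≤ dist x z + 2
    -- dist z o ≤ 3 dist x z.
    · linarith
    · rcases hz.2 with hzρ' | ⟨hzR, -⟩
      · have := hρ i
        linarith
      -- Absence of conflict costs 2 dist x z + 4η, moving `f (s n)` from x to z costs dist x z, and
      -- replacing it by `g` at z costs η.
      · have h1 : |f (s i) z - g z| < 2 * dist x z + 4 * η := by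
          by_contra hcon
          exact hxN i hin ⟨z, hz.1, hzR, not_lt.1 hcon⟩
        have h2 := hf (s n) x z
        have e : f (s n) x - f (s i) z =
          (f (s n) x - f (s n) z) + (f (s n) z - g z) + -(f (s i) z - g z) := by ring
        have h3 := abs_add_three (f (s n) x - f (s n) z) (f (s n) z - g z) (-(f (s i) z - g z))
        rw [← e, abs_neg] at h3
        linarith
  -- The index `none` is the base point with value 0; it keeps `P₀ o` within 5η of 0, so P can be
  -- normalized by subtracting it.
  obtain ⟨P₀, hP₀L, hP₀⟩ := exists_isLip_of_data (ι := Option (Σ n, D n))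
    (fun i => i.elim o fun p => p.2) (fun i => i.elim 0 fun p => f (s p.1) p.2) (L := 3)
    (e := 5 * η) (by norm_num) (by
      rintro (_ | ⟨n, x, hx⟩) (_ | ⟨i, z, hz⟩)
      · simp [hη0.le]
      · have := abs_le.1 (hfabs (s i) z)
        have h0 : (0 : ℝ) ≤ dist z o := dist_nonneg
        simp only [Option.elim, dist_comm o z]
        linarith
      · have := abs_le.1 (hfabs (s n) x)
        have h0 : (0 : ℝ) ≤ dist x o := dist_nonneg
        simp only [Option.elim]
        linarith
      · simp only [Option.elim]
        rcases lt_trichotomy i n with h | h | h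
        · have := abs_le.1 (hcons i n h x hx z hz)
          linarith
        · subst h
          have := abs_le.1 (hf (s i) x z)
          have h0 : (0 : ℝ) ≤ dist x z := dist_nonneg
          linarith
        · have := abs_le.1 (hcons n i h z hz x hx)
          rw [dist_comm z x] at this
          linarith)
  have hPo := hP₀ none
  simp only [Option.elim] at hPo
  set P : M → ℝ := fun x => P₀ x - P₀ o with hP
  have hPL : IsLip 3 P := fun x y => by simpa [hP] using hP₀L x y
  have hP0 : P o = 0 := sub_self _
  have hPD : ∀ n, ∀ x ∈ D n, |P x - f (s n) x| ≤ 5 * η := by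
    intro n x hx
    have := hP₀ (some ⟨n, x, hx⟩)
    simp only [Option.elim] at this
    rw [abs_le, hP]
    constructor <;> linarith
  refine ⟨P, hPL, hP0, fun n => ⟨s n, hs.id_le n, ?_⟩⟩
  have hρR : 2 * R ≤ ρ n := by linarith [hρ n]
  have hρ0 : 0 < ρ n := by linarith
  -- the part of the measure in the annulus is negligible
  have hann : ∀ (L : ℝ), 0 < L → ∀ F : M → ℝ, IsLip L F → F o = 0 →
      |pair (fun x => F x * (cutoff o (ρ n) x - cutoff o R x)) (a (s n))| ≤ 6 * L * (ε / 72) := by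
    intro L hL F hF hF0
    have h6 : 0 < 6 * L := by positivity
    have h1 := (hF.mul_cutoff_sub hL.le hF0 hR hρ0).const_mul (inv_nonneg.2 h6.le)
    rw [inv_mul_cancel₀ h6.ne'] at h1
    have h2 := hsmall n _ h1 (by
      intro x hx
      constructor
      · by_contra hcon
        have hxR := (not_le.1 hcon).le
        refine hx ?_
        rw [cutoff_eq_one hR hxR, cutoff_eq_one hρ0 (by linarith)]
        simp
      · by_contra hcon
        have hxR := not_lt.1 hcon
        refine hx ?_
        rw [cutoff_eq_zero hρ0 hxR, cutoff_eq_zero hR (by linarith)]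
        simp)
    rw [pair_smul, abs_mul, abs_of_pos (inv_pos.2 h6), inv_mul_le_iff₀ h6] at h2
    exact h2
  have hsplit : ∀ F : M → ℝ, pair F (a (s n)) =
      pair (fun x => F x * (cutoff o (ρ n) x - cutoff o R x)) (a (s n)) +
      pair (fun x => F x * (1 - (cutoff o (ρ n) x - cutoff o R x))) (a (s n)) := by
    intro F
    rw [← pair_add]
    congr 1
    ext x
    ring
  have hmain : |pair (fun x => P x * (1 - (cutoff o (ρ n) x - cutoff o R x))) (a (s n)) -
      pair (fun x => f (s n) x * (1 - (cutoff o (ρ n) x - cutoff o R x))) (a (s n))| ≤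
      5 * η * C₁ + 8 * R * (ε / (24 * R)) := by
    rw [← pair_sub]
    have hpt : ∀ x ∈ (a (s n)).support,
        |a (s n) x * (P x * (1 - (cutoff o (ρ n) x - cutoff o R x)) -
          f (s n) x * (1 - (cutoff o (ρ n) x - cutoff o R x)))| ≤
        5 * η * |a (s n) x| + 8 * R * ∑ i ∈ Finset.range n, (N i).indicator (fun x => |a (s n) x|) x := by
      intro x hx
      have hind : ∀ i, 0 ≤ (N i).indicator (fun x => |a (s n) x|) x := fun i =>
        Set.indicator_nonneg (fun _ _ => abs_nonneg _) _
      have hnn : 0 ≤ 8 * R * ∑ i ∈ Finset.range n, (N i).indicator (fun x => |a (s n) x|) x :=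
        mul_nonneg (by positivity) (Finset.sum_nonneg fun i _ => hind i)
      have hnn' : 0 ≤ 5 * η * |a (s n) x| := by positivity
      rcases lt_or_ge (2 * R) (dist x o) with h1 | h1
      · rcases lt_or_ge (dist x o) (ρ n) with h2 | h2
        · rw [cutoff_eq_one hρ0 h2.le, cutoff_eq_zero hR h1.le]
          simp only [sub_zero, sub_self, mul_zero, abs_zero]
          linarith
        · rw [← sub_mul, abs_mul, abs_mul]
          have h3 := hPD n x ⟨hx, Or.inl h2⟩
          have h4 : |1 - (cutoff o (ρ n) x - cutoff o R x)| ≤ 1 := by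
            rw [cutoff_eq_zero hR h1.le, sub_zero, abs_le]
            have := cutoff_nonneg o (ρ n) x
            have := cutoff_le_one o (ρ n) x
            constructor <;> linarith
          have h5 := mul_le_mul h3 h4 (abs_nonneg _) (by positivity)
          have h6 := mul_le_mul_of_nonneg_left h5 (abs_nonneg (a (s n) x))
          linarith
      · rw [← sub_mul, abs_mul, abs_mul]
        have h4 : |1 - (cutoff o (ρ n) x - cutoff o R x)| ≤ 1 := by
          rw [cutoff_eq_one hρ0 (h1.trans hρR), abs_le]
          have := cutoff_nonneg o R x
          have := cutoff_le_one o R x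
          constructor <;> linarith
        by_cases hxN : ∃ i < n, x ∈ N i
        · obtain ⟨i, hi, hxi⟩ := hxN
          have h2 : |a (s n) x| ≤ ∑ i ∈ Finset.range n, (N i).indicator (fun x => |a (s n) x|) x := by
            refine le_trans (le_of_eq ?_)
              (Finset.single_le_sum (fun i _ => hind i) (Finset.mem_range.2 hi))
            rw [Set.indicator_of_mem hxi]
          -- On conflict points only the crude bound 3·2R + 2R is available; their small mass
          -- compensates.
          have h3 : |P x - f (s n) x| ≤ 8 * R := by
            have := hPL.abs_le hP0 x
            have := hfabs (s n) x
            have := abs_sub (P x) (f (s n) x)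
            linarith
          have h5 := mul_le_mul h3 h4 (abs_nonneg _) (by positivity)
          have h6 := mul_le_mul_of_nonneg_left h5 (abs_nonneg (a (s n) x))
          have h7 := mul_le_mul_of_nonneg_left h2 (show 0 ≤ 8 * R by positivity)
          linarith
        · push Not at hxN
          have h3 := hPD n x ⟨hx, Or.inr ⟨h1, hxN⟩⟩
          have h5 := mul_le_mul h3 h4 (abs_nonneg _) (by positivity)
          have h6 := mul_le_mul_of_nonneg_left h5 (abs_nonneg (a (s n) x))
          linarith
    refine (Finset.abs_sum_le_sum_abs _ _).trans ((Finset.sum_le_sum hpt).trans ?_)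
    rw [Finset.sum_add_distrib, ← Finset.mul_sum, ← Finset.mul_sum, Finset.sum_comm]
    have h1 := hmass n
    unfold mass at h1
    gcongr
    exact hC₁ (s n)
  have hηC : 5 * η * C₁ ≤ ε / 3 := by
    rw [hη, mul_div_assoc', div_mul_eq_mul_div, div_le_div_iff₀ (by positivity) (by norm_num)]
    nlinarith
  have hRε : 8 * R * (ε / (24 * R)) = ε / 3 := by
    field_simp
    norm_num
  -- The annulus costs ε/4 for P and ε/12 for `f (s n)`; `hmain` costs 2ε/3.
  have h1 := abs_le.1 (hann 3 (by norm_num) P hPL hP0)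
  have h2 := abs_le.1 (hann 1 one_pos (f (s n)) (hf _) (hf0 _))
  have h3 := abs_le.1 hmain
  have h4 := hc (s n)
  rw [hsplit] at h4 ⊢
  linarith

end Core

/-! ### The 3-Schur property. -/

section UpperBound

variable {M : Type*} [MetricSpace M] {o : M}

/-- A Lipschitz function that vanishes at `o`, as an element of `Lip₀(M)`. -/
def LipZero.ofIsLip {K : ℝ} (f : M → ℝ) (hf : IsLip K f) (h0 : f o = 0) : LipZero o :=
  (⟨f, ⟨K.toNNReal, LipschitzWith.of_dist_le_mul fun x y => (hf x y).trans
    (mul_le_mul_of_nonneg_right (Real.le_coe_toNNReal K) dist_nonneg)⟩, h0⟩ : lipZeroSubmodule o)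

@[simp] theorem LipZero.ofIsLip_apply {K : ℝ} (f : M → ℝ) (hf : IsLip K f) (h0 : f o = 0) (x : M) :
    LipZero.ofIsLip f hf h0 x = f x := rfl

theorem LipZero.norm_ofIsLip_le {K : ℝ} (hK : 0 ≤ K) (f : M → ℝ) (hf : IsLip K f) (h0 : f o = 0) :
    ‖LipZero.ofIsLip f hf h0‖ ≤ K :=
  LipZero.norm_le_of_abs_sub_le _ hK hf

theorem LipZero.isLip (f : LipZero o) {K : ℝ} (hK : ‖f‖ ≤ K) : IsLip K f := fun x y =>
  (LipZero.abs_sub_le f x y).trans (mul_le_mul_of_nonneg_right hK dist_nonneg)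

theorem linearCombination_eval_apply (a : M →₀ ℝ) (f : LipZero o) :
    Finsupp.linearCombination ℝ (LipZero.eval o) a f = pair f a := by
  rw [Finsupp.linearCombination_apply, Finsupp.sum, pair, _root_.sum_apply]
  rfl

/-- Finitely supported measures without mass at the base point are dense in the free space. -/
theorem exists_finsupp_norm_sub_lt {y : StrongDual ℝ (LipZero o)} (hy : y ∈ freeSpace o) {δ : ℝ}
    (hδ : 0 < δ) :
    ∃ a : M →₀ ℝ, a o = 0 ∧ ‖y - Finsupp.linearCombination ℝ (LipZero.eval o) a‖ < δ := by
  have hy' : y ∈ closure (Submodule.span ℝ (Set.range (LipZero.eval o)) :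
      Set (StrongDual ℝ (LipZero o))) := hy
  obtain ⟨w, hw, hyw⟩ := Metric.mem_closure_iff.1 hy' δ hδ
  obtain ⟨b, rfl⟩ := (Finsupp.mem_span_range_iff_exists_finsupp).1 hw
  refine ⟨b.erase o, Finsupp.erase_same, ?_⟩
  have h0 : LipZero.eval o o = 0 := by
    ext f
    simp
  have h1 : Finsupp.linearCombination ℝ (LipZero.eval o) (b.erase o) =
      Finsupp.linearCombination ℝ (LipZero.eval o) b := by
    conv_rhs => rw [← Finsupp.erase_add_single o b]
    rw [map_add, Finsupp.linearCombination_single, h0, smul_zero, add_zero]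
  rw [h1, Finsupp.linearCombination_apply, ← dist_eq_norm]
  exact hyw

/-- On a uniformly discrete space the total variation is controlled by the free space norm. -/
theorem sum_abs_le_of_uniformlyDiscrete {r : ℝ} (hr : 0 < r)
    (hM : ∀ x y : M, x ≠ y → r ≤ dist x y) {a : M →₀ ℝ} (ha : a o = 0) {C : ℝ}
    (hC : ∀ f : M → ℝ, IsLip 1 f → f o = 0 → pair f a ≤ C) :
    ∑ x ∈ a.support, |a x| ≤ 2 / r * C := by
  have hsign : ∀ u : ℝ, |(SignType.sign u : ℝ)| ≤ 1 := by
    intro u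
    rcases lt_trichotomy u 0 with h | h | h <;> simp [h]
  -- Values in [-1, 1] at points at least `r` apart give slope at most 2/r; pairing with the sign
  -- yields the total variation.
  have hL : IsLip (2 / r) fun x => (SignType.sign (a x) : ℝ) := by
    intro x y
    rcases eq_or_ne x y with rfl | hxy
    · simp
    · have h1 := abs_sub (SignType.sign (a x) : ℝ) (SignType.sign (a y))
      have h2 := hsign (a x)
      have h3 := hsign (a y)
      have h4 : 2 ≤ 2 / r * dist x y := by
        rw [div_mul_eq_mul_div, le_div_iff₀ hr]
        linarith [hM x y hxy]
      linarith
  have := pair_le_of_isLip hC (by positivity) hL (by simp [ha])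
  simpa only [pair, self_mul_sign] using this

theorem ca_le_diam_range {E : Type*} [PseudoMetricSpace E] (x : ℕ → E) :
    ca x ≤ Metric.diam (Set.range x) := by
  refine (ciInf_le ⟨0, ?_⟩ 0).trans (le_of_eq ?_)
  · rintro _ ⟨n, rfl⟩
    exact Metric.diam_nonneg
  · rw [show Set.Ici 0 = (Set.univ : Set ℕ) from Set.Ici_bot, Set.image_univ]

theorem ca_nonneg {E : Type*} [PseudoMetricSpace E] (x : ℕ → E) : 0 ≤ ca x :=
  Real.iInf_nonneg fun _ => Metric.diam_nonneg

theorem exists_lt_dist_of_lt_ca {E : Type*} [PseudoMetricSpace E] {x : ℕ → E} {c : ℝ}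
    (hc : 0 ≤ c) (h : c < ca x) (n : ℕ) : ∃ p ≥ n, ∃ q ≥ n, c < dist (x p) (x q) := by
  by_contra hcon
  push Not at hcon
  have h1 : Metric.diam (x '' Set.Ici n) ≤ c := by
    refine Metric.diam_le_of_forall_dist_le hc ?_
    rintro _ ⟨p, hp, rfl⟩ _ ⟨q, hq, rfl⟩
    exact hcon p hp q hq
  have h2 : ca x ≤ Metric.diam (x '' Set.Ici n) := ciInf_le ⟨0, by
    rintro _ ⟨n, rfl⟩
    exact Metric.diam_nonneg⟩ n
  linarith

/-- Boundedness matters because `Metric.diam` is 0 on unbounded sets. -/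
theorem le_ca_of_forall_exists {E : Type*} [PseudoMetricSpace E] {x : ℕ → E}
    (hx : Bornology.IsBounded (Set.range x)) {c : ℝ}
    (h : ∀ n, ∃ p ≥ n, ∃ q ≥ n, c ≤ dist (x p) (x q)) : c ≤ ca x := by
  refine le_ciInf fun n => ?_
  obtain ⟨p, hp, q, hq, hpq⟩ := h n
  exact hpq.trans (Metric.dist_le_diam_of_mem (hx.subset (Set.image_subset_range _ _))
    ⟨p, hp, rfl⟩ ⟨q, hq, rfl⟩)

theorem weakCa_nonneg {X : Type*} [NormedAddCommGroup X] [NormedSpace ℝ X] (x : ℕ → X) :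
    0 ≤ weakCa x := by
  refine Real.sSup_nonneg ?_
  rintro _ ⟨φ, -, rfl⟩
  exact ca_nonneg _

theorem ca_le_weakCa {X : Type*} [NormedAddCommGroup X] [NormedSpace ℝ X] {x : ℕ → X}
    (hx : Bornology.IsBounded (Set.range x)) {φ : StrongDual ℝ X} (hφ : ‖φ‖ ≤ 1) :
    (ca fun n => φ (x n)) ≤ weakCa x := by
  refine le_csSup ⟨Metric.diam (Set.range x), ?_⟩ ⟨φ, hφ, rfl⟩
  rintro _ ⟨ψ, hψ, rfl⟩
  refine (ca_le_diam_range _).trans (Metric.diam_le_of_forall_dist_le Metric.diam_nonneg ?_)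
  rintro _ ⟨p, rfl⟩ _ ⟨q, rfl⟩
  rw [dist_eq_norm, ← map_sub]
  refine (ψ.le_of_opNorm_le hψ _).trans ?_
  rw [one_mul, ← dist_eq_norm]
  exact Metric.dist_le_diam_of_mem hx ⟨p, rfl⟩ ⟨q, rfl⟩

/-- A lower bound of `weakCa` by means of a linear functional of norm at most one. -/
theorem le_weakCa_of_linearMap {X : Type*} [NormedAddCommGroup X] [NormedSpace ℝ X] {x : ℕ → X}
    (hx : Bornology.IsBounded (Set.range x)) (L : X →ₗ[ℝ] ℝ) (hL : ∀ w, |L w| ≤ ‖w‖) {c : ℝ}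
    (h : ∀ n, ∃ p ≥ n, ∃ q ≥ n, c ≤ |L (x p - x q)|) : c ≤ weakCa x := by
  have hL' : ∀ w, ‖L w‖ ≤ 1 * ‖w‖ := fun w => by simpa using hL w
  have hφ : ‖L.mkContinuous 1 hL'‖ ≤ 1 := L.mkContinuous_norm_le zero_le_one hL'
  refine le_trans (le_ca_of_forall_exists ?_ fun n => ?_) (ca_le_weakCa hx hφ)
  · obtain ⟨B, hB⟩ := isBounded_iff_forall_norm_le.1 hx
    refine isBounded_iff_forall_norm_le.2 ⟨B, ?_⟩
    rintro _ ⟨n, rfl⟩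
    exact (hL _).trans (hB _ ⟨n, rfl⟩)
  · obtain ⟨p, hp, q, hq, hpq⟩ := h n
    refine ⟨p, hp, q, hq, ?_⟩
    rwa [dist_eq_norm, ← map_sub]

/-- An upper bound of `weakCa` by means of the linear functionals of norm at most one. -/
theorem weakCa_le_of_linearMap {X : Type*} [NormedAddCommGroup X] [NormedSpace ℝ X] {x : ℕ → X}
    {c : ℝ} (h : ∀ L : X →ₗ[ℝ] ℝ, (∀ w, |L w| ≤ ‖w‖) → (ca fun n => L (x n)) ≤ c) :
    weakCa x ≤ c := by
  refine csSup_le ⟨_, 0, by simp, rfl⟩ ?_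
  rintro _ ⟨φ, hφ, rfl⟩
  exact h φ fun w => by simpa using φ.le_of_opNorm_le hφ w

theorem exists_lt_apply_of_lt_norm {y : StrongDual ℝ (LipZero o)} {c : ℝ} (hc : 0 ≤ c)
    (h : c < ‖y‖) : ∃ f : LipZero o, ‖f‖ ≤ 1 ∧ c < y f := by
  obtain ⟨f, hf, hcf⟩ : ∃ f : LipZero o, ‖f‖ ≤ 1 ∧ c < ‖y f‖ := by
    by_contra hcon
    push Not at hcon
    exact absurd (ContinuousLinearMap.opNorm_le_of_unit_norm hc fun f hf => hcon f hf.le)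
      (not_le.2 h)
  rcases lt_abs.1 hcf with h1 | h1
  · exact ⟨f, hf, h1⟩
  · exact ⟨-f, by rwa [norm_neg], by rwa [map_neg]⟩

theorem isSchur_three_freeSpace (hM : UniformlyDiscrete M) (o : M) : IsSchur 3 (freeSpace o) := by
  obtain ⟨r, hr, hM⟩ := hM
  intro x hx
  by_contra! hlt
  obtain ⟨c, hc1, hc2⟩ := exists_between hlt
  have hw := weakCa_nonneg x
  have hc0 : 0 ≤ c := by linarith
  choose p hp q hq hpq using exists_lt_dist_of_lt_ca hc0 hc2
  -- The total loss is 5ε: ε for passing from `y n` to `a n`, ε in `exists_isLip_three`, and 3ε for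
  -- returning to `y k` with a function of norm 3.
  set ε := (c - 3 * weakCa x) / 12 with hε
  have hε0 : 0 < ε := by
    rw [hε]
    linarith
  obtain ⟨B, hB⟩ := (isBounded_iff_forall_norm_le (E := freeSpace o)).1 hx
  set y : ℕ → StrongDual ℝ (LipZero o) := fun n => (x (p n) : StrongDual ℝ (LipZero o)) - x (q n)
    with hy
  have hyc : ∀ n, c < ‖y n‖ := fun n => by
    have := hpq n
    rwa [dist_eq_norm] at this
  have hyB : ∀ n, ‖y n‖ ≤ 2 * B := fun n => by
    have h1 := hB _ ⟨p n, rfl⟩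
    have h2 := hB _ ⟨q n, rfl⟩
    have h3 := norm_sub_le (x (p n) : StrongDual ℝ (LipZero o)) (x (q n))
    rw [Submodule.coe_norm] at h1 h2
    rw [hy]
    simp only
    linarith
  choose a ha0 ha using fun n =>
    exists_finsupp_norm_sub_lt ((freeSpace o).sub_mem (x (p n)).2 (x (q n)).2) hε0
  choose f hf hfc using fun n => exists_lt_apply_of_lt_norm hc0 (hyc n)
  have happ : ∀ n, ∀ K : ℝ, ∀ F : LipZero o, ‖F‖ ≤ K → |y n F - pair F (a n)| ≤ ε * K := by
    intro n K F hF
    rw [← linearCombination_eval_apply (o := o), ← _root_.sub_apply]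
    exact (ContinuousLinearMap.le_opNorm _ _).trans
      (mul_le_mul (ha n).le hF (norm_nonneg _) hε0.le)
  have hC : ∀ n, ∀ F : M → ℝ, IsLip 1 F → F o = 0 → pair F (a n) ≤ 2 * B + ε := by
    intro n F hF hF0
    have h1 := LipZero.norm_ofIsLip_le zero_le_one F hF hF0
    have h2 := abs_le.1 (happ n 1 _ h1)
    have h3 := ((y n).le_of_opNorm_le_of_le (hyB n) h1)
    have h4 := (abs_le.1 h3).2
    have h5 : pair (LipZero.ofIsLip F hF hF0) (a n) = pair F (a n) := rfl
    linarith
  obtain ⟨P, hP, hP0, hPk⟩ := exists_isLip_three (f := fun n => f n) hC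
    (fun n => sum_abs_le_of_uniformlyDiscrete hr hM (ha0 n) (hC n))
    (fun n => (f n).isLip (hf n)) (fun n => (f n).apply_base) (c := c - ε) (fun n => by
      have h1 := abs_le.1 (happ n 1 _ (hf n))
      have h2 := hfc n
      linarith) hε0
  set G : LipZero o := LipZero.ofIsLip P hP hP0 with hG
  have hGn : ‖G‖ ≤ 3 := LipZero.norm_ofIsLip_le (by norm_num) P hP hP0
  let φ : freeSpace o →ₗ[ℝ] ℝ :=
    { toFun := fun w : freeSpace o => (w : StrongDual ℝ (LipZero o)) G / 3
      map_add' := fun w w' => by simp [add_div]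
      map_smul' := fun t w => by simp [mul_div_assoc] }
  have hφ : ∀ w, |φ w| ≤ ‖w‖ := fun w => by
    have h := (w : StrongDual ℝ (LipZero o)).le_opNorm_of_le hGn
    change |(w : StrongDual ℝ (LipZero o)) G / 3| ≤ ‖w‖
    rw [abs_div, abs_of_pos (three_pos (α := ℝ)), div_le_iff₀ three_pos]
    exact h
  have hfin : (c - 5 * ε) / 3 ≤ weakCa x := by
    refine le_weakCa_of_linearMap hx φ hφ fun N => ?_
    obtain ⟨k, hk, hkP⟩ := hPk N
    refine ⟨p k, hk.trans (hp k), q k, hk.trans (hq k), ?_⟩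
    have h1 := abs_le.1 (happ k 3 G hGn)
    have h2 : pair G (a k) = pair P (a k) := rfl
    rw [h2] at h1
    have e : φ (x (p k) - x (q k)) = y k G / 3 := rfl
    rw [e]
    refine le_trans ?_ (le_abs_self _)
    linarith
  linarith

end UpperBound

/-! ### Optimality of the constant. -/

section Example

/-- The points of a space made of infinitely many blocks of four points each, which are two
pairs. -/
@[ext]
structure PairedBlocks : Type where
  /-- The number of the block. -/
  block : ℕ
  /-- Which of the two pairs of the block. -/
  which : Bool
  /-- The position in the pair. -/
  pos : Bool

namespace PairedBlocks

/-- The distance: `3` within a block, `1` between points of pairs with the same number in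
different blocks that have different positions in their pairs, and `2` otherwise. -/
def gap (x y : PairedBlocks) : ℝ :=
  if x.block = y.block then (if x.which = y.which ∧ x.pos = y.pos then 0 else 3)
  else if x.which = y.which ∧ x.pos ≠ y.pos then 1 else 2

theorem gap_self (x : PairedBlocks) : gap x x = 0 := by simp [gap]

theorem gap_comm (x y : PairedBlocks) : gap x y = gap y x := by
  simp only [gap, eq_comm, ne_comm, ne_eq]

theorem gap_triangle (x y z : PairedBlocks) : gap x z ≤ gap x y + gap y z := by
  obtain ⟨i, s, t⟩ := x
  obtain ⟨j, s', t'⟩ := y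
  obtain ⟨k, s'', t''⟩ := z
  simp only [gap]
  rcases eq_or_ne i k with rfl | h3
  · rcases eq_or_ne i j with rfl | h1
    · simp only [if_true]
      revert s t s' t' s'' t''
      norm_num
    · simp only [h1, h1.symm, if_true, if_false]
      revert s t s' t' s'' t''
      norm_num
  · rcases eq_or_ne i j with rfl | h1
    · simp only [h3, if_true, if_false]
      revert s t s' t' s'' t''
      norm_num
    · rcases eq_or_ne j k with rfl | h2
      · simp only [h1, if_true, if_false]
        revert s t s' t' s'' t''
        norm_num
      · simp only [h1, h2, h3, if_false]
        revert s t s' t' s'' t''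
        norm_num

theorem one_le_gap {x y : PairedBlocks} (h : x ≠ y) : 1 ≤ gap x y := by
  rw [ne_eq, PairedBlocks.ext_iff] at h
  unfold gap
  split_ifs <;> first | (exfalso; tauto) | norm_num

noncomputable instance : MetricSpace PairedBlocks where
  dist := gap
  dist_self := gap_self
  dist_comm := gap_comm
  dist_triangle := gap_triangle
  eq_of_dist_eq_zero {x y} h := by
    by_contra hne
    have := one_le_gap hne
    change gap x y = 0 at h
    linarith

theorem dist_def (x y : PairedBlocks) : dist x y = gap x y := rfl

theorem uniformlyDiscrete : UniformlyDiscrete PairedBlocks :=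
  ⟨1, one_pos, fun _ _ h => one_le_gap h⟩

theorem dist_le_three (x y : PairedBlocks) : dist x y ≤ 3 := by
  rw [dist_def, gap]
  split_ifs <;> norm_num

/-- A function that separates the two pairs of a block as far as possible. -/
def separator (n : ℕ) (x : PairedBlocks) : ℝ :=
  if x.block = n then (if x.which = x.pos then 3 else 0) else (if x.which = x.pos then 1 else 2)

/-- Off block `n`, the points at distance 1 from a point of value 3 have value 2, and those at
distance 1 from a point of value 0 have value 1. -/
theorem isLip_separator (n : ℕ) : IsLip 1 (separator n) := by
  rintro ⟨i, s, t⟩ ⟨j, s', t'⟩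
  rw [dist_def, one_mul]
  simp only [gap, separator]
  by_cases h1 : i = j
  · subst h1
    by_cases h2 : i = n
    · simp only [h2, if_true]
      revert s t s' t'
      norm_num
    · simp only [h2, if_true, if_false]
      revert s t s' t'
      norm_num
  · by_cases h2 : i = n
    · subst h2
      simp only [h1, Ne.symm h1, if_true, if_false]
      revert s t s' t'
      norm_num
    · by_cases h3 : j = n
      · simp only [h2, h3, if_true, if_false]
        revert s t s' t'
        norm_num
      · simp only [h1, h2, h3, if_false]
        revert s t s' t'
        norm_num

end PairedBlocks

/-- The point evaluation as an element of the free space. -/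
noncomputable def pointMass {M : Type*} [MetricSpace M] (o x : M) : freeSpace o :=
  ⟨LipZero.eval o x, subset_closure (Submodule.subset_span ⟨x, rfl⟩)⟩

theorem norm_pointMass_sub_le {M : Type*} [MetricSpace M] (o x y : M) :
    ‖pointMass o x - pointMass o y‖ ≤ dist x y := by
  rw [Submodule.coe_norm]
  refine ContinuousLinearMap.opNorm_le_bound _ dist_nonneg fun f => ?_
  rw [mul_comm]
  exact LipZero.abs_sub_le f x y

theorem abs_apply_pointMass_sub_le {M : Type*} [MetricSpace M] {o : M}
    {φ : freeSpace o →ₗ[ℝ] ℝ} (hφ : ∀ w, |φ w| ≤ ‖w‖) (x y : M) :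
    |φ (pointMass o x) - φ (pointMass o y)| ≤ dist x y := by
  rw [← map_sub]
  exact (hφ _).trans (norm_pointMass_sub_le o x y)

namespace PairedBlocks

/-- The differences of the two points of a pair, for all pairs of all blocks in turn. -/
noncomputable def pairDiff (o : PairedBlocks) (n : ℕ) : freeSpace o :=
  pointMass o ⟨n / 2, n.bodd, false⟩ - pointMass o ⟨n / 2, n.bodd, true⟩

theorem isBounded_range_pairDiff (o : PairedBlocks) :
    Bornology.IsBounded (Set.range (pairDiff o)) := by
  refine (isBounded_iff_forall_norm_le (E := freeSpace o)).2 ⟨3, ?_⟩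
  rintro _ ⟨n, rfl⟩
  exact (norm_pointMass_sub_le _ _ _).trans (dist_le_three _ _)

/-- The indices 2n and 2n + 1 are the two pairs of block n, on which `separator n` has increments 3
and -3. -/
theorem six_le_ca_pairDiff (o : PairedBlocks) : 6 ≤ ca (pairDiff o) := by
  refine le_ca_of_forall_exists (isBounded_range_pairDiff o) fun n =>
    ⟨2 * n, by omega, 2 * n + 1, by omega, ?_⟩
  have hL : IsLip 1 fun x => separator n x - separator n o := fun x y => by
    simpa using isLip_separator n x y
  set F : LipZero o := LipZero.ofIsLip _ hL (sub_self _) with hF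
  have hFn : ‖F‖ ≤ 1 := LipZero.norm_ofIsLip_le zero_le_one _ _ _
  have h1 : ((pairDiff o (2 * n) - pairDiff o (2 * n + 1) : freeSpace o) :
      StrongDual ℝ (LipZero o)) F = 6 := by
    have e1 : (2 * n) / 2 = n := by omega
    have e2 : (2 * n + 1) / 2 = n := by omega
    have e3 : (2 * n).bodd = false := by simp
    have e4 : (2 * n + 1).bodd = true := by simp
    simp only [pairDiff, pointMass, e1, e2, e3, e4, AddSubgroupClass.coe_sub,
      _root_.sub_apply, LipZero.eval_apply, hF, LipZero.ofIsLip_apply, separator]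
    norm_num
    ring
  refine le_of_le_of_eq ?_ (dist_eq_norm (pairDiff o (2 * n) : StrongDual ℝ (LipZero o))
    (pairDiff o (2 * n + 1))).symm
  have h2 := ContinuousLinearMap.le_opNorm_of_le
    ((pairDiff o (2 * n) - pairDiff o (2 * n + 1) : freeSpace o) : StrongDual ℝ (LipZero o)) hFn
  rw [h1, mul_one, Real.norm_of_nonneg (by norm_num)] at h2
  exact h2

/-- If `h` nearly agrees at (j, s, true) and (k, s, true) with j ≠ k, then the increment over pair s
of block j is at most about 1, because (j, s, false) is at distance 1 from (k, s, true). As `h` is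
bounded, rounding leaves finitely many exceptions. -/
theorem finite_setOf_lt_abs_sub {h : PairedBlocks → ℝ} (hh : ∀ x y, |h x - h y| ≤ dist x y)
    (s : Bool) {δ : ℝ} (hδ : 0 < δ) :
    {k : ℕ | 1 + δ < |h ⟨k, s, false⟩ - h ⟨k, s, true⟩|}.Finite := by
  set u : ℕ → ℝ := fun k => h ⟨k, s, true⟩ with hu
  refine Set.Finite.of_injOn (f := fun k => ⌊u k / δ⌋)
    (t := Set.Icc ⌊(u 0 - 3) / δ⌋ ⌊(u 0 + 3) / δ⌋) ?_ ?_ (Set.finite_Icc _ _)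
  · intro k _
    have := abs_le.1 ((hh ⟨k, s, true⟩ ⟨0, s, true⟩).trans (dist_le_three _ _))
    constructor
    · exact Int.floor_le_floor (by gcongr; simp only [hu]; linarith)
    · exact Int.floor_le_floor (by gcongr; simp only [hu]; linarith)
  · intro j hj k _ hjk
    by_contra hne
    have h1 := abs_sub_lt_of_floor_div_eq hδ hjk
    have h2 := hh ⟨j, s, false⟩ ⟨k, s, true⟩
    have h3 : dist (⟨j, s, false⟩ : PairedBlocks) ⟨k, s, true⟩ = 1 := by
      simp [dist_def, gap, hne]
    have h4 : 1 + δ < |h ⟨j, s, false⟩ - h ⟨j, s, true⟩| := hj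
    have h5 := abs_sub_le (h ⟨j, s, false⟩) (h ⟨k, s, true⟩) (h ⟨j, s, true⟩)
    rw [abs_sub_comm (h ⟨k, s, true⟩)] at h5
    simp only [hu] at h1
    linarith

theorem weakCa_pairDiff_le (o : PairedBlocks) : weakCa (pairDiff o) ≤ 2 := by
  refine weakCa_le_of_linearMap fun φ hφ => ?_
  refine le_of_forall_pos_le_add fun δ hδ => ?_
  have hfin := fun s => (finite_setOf_lt_abs_sub (h := fun x => φ (pointMass o x))
    (abs_apply_pointMass_sub_le hφ) s (half_pos hδ)).bddAbove
  choose N hN using hfin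
  -- `K` exceeds every exceptional block number; index n belongs to block n / 2, hence the threshold
  -- 2K.
  set K := max (N false) (N true) + 1 with hK
  have hbound : ∀ n ≥ 2 * K, |φ (pairDiff o n)| ≤ 1 + δ / 2 := by
    intro n hn
    by_contra hcon
    have e : φ (pairDiff o n) = φ (pointMass o ⟨n / 2, n.bodd, false⟩) -
      φ (pointMass o ⟨n / 2, n.bodd, true⟩) := map_sub φ _ _
    rw [e, not_le] at hcon
    have h1 : n / 2 ≤ N n.bodd := hN n.bodd hcon
    have h2 : N n.bodd ≤ max (N false) (N true) := by cases n.bodd <;> simp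
    omega
  refine (ciInf_le ⟨0, ?_⟩ (2 * K)).trans (Metric.diam_le_of_forall_dist_le (by positivity) ?_)
  · rintro _ ⟨n, rfl⟩
    exact Metric.diam_nonneg
  · rintro _ ⟨p, hp, rfl⟩ _ ⟨q, hq, rfl⟩
    have h1 := hbound p hp
    have h2 := hbound q hq
    have h3 := abs_sub (φ (pairDiff o p)) (φ (pairDiff o q))
    rw [Real.dist_eq]
    linarith

theorem not_isSchur (o : PairedBlocks) {c : ℝ} (hc : c < 3) : ¬ IsSchur c (freeSpace o) := by
  intro h
  have h1 : ca (pairDiff o) ≤ c * weakCa (pairDiff o) := h _ (isBounded_range_pairDiff o)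
  have h2 := six_le_ca_pairDiff o
  have h3 := weakCa_pairDiff_le o
  have h4 := weakCa_nonneg (pairDiff o)
  rcases le_or_gt c 0 with h0 | h0
  · linarith [mul_nonpos_of_nonpos_of_nonneg h0 h4]
  · linarith [mul_le_mul_of_nonneg_left h3 h0.le]

end PairedBlocks

end Example

end LipFree

theorem theorem1p1 :
    (∀ (M : Type*) [MetricSpace M], LipFree.UniformlyDiscrete M →
      ∀ o : M, LipFree.IsSchur 3 (LipFree.freeSpace o)) ∧
    ∃ (M : Type) (_ : MetricSpace M), Nonempty M ∧ LipFree.UniformlyDiscrete M ∧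
      ∀ o : M, ∀ c : ℝ, c < 3 → ¬ LipFree.IsSchur c (LipFree.freeSpace o) :=
  ⟨fun _ _ hM o => LipFree.isSchur_three_freeSpace hM o,
    LipFree.PairedBlocks, inferInstance, ⟨⟨0, false, false⟩⟩,
    LipFree.PairedBlocks.uniformlyDiscrete, fun o _ hc => LipFree.PairedBlocks.not_isSchur o hc⟩
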